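/- All graphs are finite, simple and connected. A cactus graph is a connected graph whose cycles are pairwise edge-disjoint, and a leaf is a vertex of degree $1$. For vertices $u,v$ of $G$ let $d(u,v)$ be the length of a shortest path between them, and for an edge $e=vw$ let $d(u,e)=\min\{d(u,v),d(u,w)\}$. A set $S\subseteq V(G)$ is an edge metric generator of $G$ if for every two distinct edges $e,f$ of $G$ there is $s\in S$ with $d(s,e)\neq d(s,f)$; the edge metric dimension $\mathrm{edim}(G)$ is the cardinality of a smallest edge metric generator. A daisy graph is a graph that is the union of at least two cycles (of arbitrary lengths) such that one vertex lies on all of these cycles and any two of them have no other vertex in common. **Proposition.** Let $G$ be a cactus graph with $c\geq 2$ cycles and without leaves. Then $$\mathrm{edim}(G)\leq 2c-1,$$ with equality if and only if $G$ is a daisy graph. -/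

import Mathlib

namespace SimpleGraph

variable {V : Type*}

/-- The cycles of `G`, as subgraphs: closed walks that differ only in their starting point or
their orientation give the same cycle. -/
def cycles (G : SimpleGraph V) : Set G.Subgraph :=
  {C | ∃ (v : V) (p : G.Walk v v), p.IsCycle ∧ p.toSubgraph = C}

/-- A cactus graph: a connected graph whose cycles are pairwise edge disjoint. -/
def IsCactus (G : SimpleGraph V) : Prop :=
  G.Connected ∧ G.cycles.Pairwise fun C D => Disjoint C.edgeSet D.edgeSet

/-- A daisy graph: `G` is the union of at least two cycles (the petals), any two of which
have precisely the vertex `x` (the center) in common. -/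
def IsDaisy (G : SimpleGraph V) : Prop :=
  ∃ (x : V) (P : Set G.Subgraph), P.Nontrivial ∧ P ⊆ G.cycles ∧
    (P.Pairwise fun C D => C.verts ∩ D.verts = {x}) ∧ sSup P = ⊤

/-- The distance from a vertex `s` to an edge `vw`, namely `min (d(s, v)) (d(s, w))`. -/
noncomputable def edgeDist (G : SimpleGraph V) (s : V) : Sym2 V → ℕ :=
  Sym2.lift ⟨fun v w => min (G.dist s v) (G.dist s w), fun _ _ => min_comm _ _⟩

/-- `S` is an edge metric generator of `G`: any two distinct edges of `G` are at different
distances from some vertex of `S`. -/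
def IsEdgeMetricGenerator (G : SimpleGraph V) (S : Finset V) : Prop :=
  ∀ e ∈ G.edgeSet, ∀ f ∈ G.edgeSet, e ≠ f → ∃ s ∈ S, G.edgeDist s e ≠ G.edgeDist s f

/-- The edge metric dimension: the cardinality of a smallest edge metric generator. (In a
finite connected graph the set of all vertices is one.) -/
noncomputable def edim (G : SimpleGraph V) : ℕ :=
  sInf {n : ℕ | ∃ S : Finset V, G.IsEdgeMetricGenerator S ∧ S.card = n}

end SimpleGraph

namespace SimpleGraph

variable {V : Type*} {G : SimpleGraph V}

/-! In a cactus every vertex hangs at a single vertex of a given cycle `C`, its gate. A distance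
between vertices with different gates splits into the way to one gate, the way around `C`, and the
way from the other gate.

Upper bound (`IsCactus.isEdgeMetricGenerator`): number each cycle, of length `n`, from a vertex at
which another cycle hangs; a chosen vertex of that other cycle then stands in for vertex `0`. Choose
vertex `1` on every cycle and vertex `⌈n/2⌉` on each cycle outside a set `W`. Vertices `0`, `1`
separate the edges of the cycle from one another, and `0`, `1`, `⌈n/2⌉` separate them from edges of
other cycles. An edge in no cycle is a bridge, with a cycle on either side since there are no
leaves. `W` may be a single cycle, giving `2c - 1`, or two disjoint cycles facing each other, giving
`2c - 2`. So equality forces the cycles to meet pairwise, hence in one vertex (`IsCactus.isDaisy`).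

Lower bound for a daisy (`IsDaisy.le_card_of_isEdgeMetricGenerator`): each petal contains a
generator vertex other than the center, and a petal with only one has an edge that is as far as the
center from every generator vertex. Two such petals would leave two edges unseparated. -/

/-! ### Coordinates on a cycle of a cactus -/

/-- The distance between the vertices numbered `i` and `j` in a cycle of length `n`. -/
def cycDist (n i j : ℕ) : ℕ :=
  min ((i - j) + (j - i)) (n - ((i - j) + (j - i)))

/-- Coordinates on a cycle `C` of `G`: a numbering of its vertices along the cycle, and the map
sending each vertex of `G` to the number of the vertex of `C` at which it hangs. -/
structure CycleCoords (G : SimpleGraph V) (C : G.Subgraph) where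
  n : ℕ
  vert : ℕ → V
  gate : V → ℕ
  three_le : 3 ≤ n
  vert_n : vert n = vert 0
  adj_vert : ∀ i < n, G.Adj (vert i) (vert (i + 1))
  mem_verts : ∀ z, z ∈ C.verts ↔ ∃ i < n, z = vert i
  mem_edgeSet : ∀ e, e ∈ C.edgeSet ↔ ∃ i < n, e = s(vert i, vert (i + 1))
  gate_lt : ∀ z, gate z < n
  gate_vert : ∀ i < n, gate (vert i) = i
  gate_eq_of_adj : ∀ z w, G.Adj z w → s(z, w) ∉ C.edgeSet → gate z = gate w
  reachable_gate : ∀ z, (G.deleteEdges C.edgeSet).Reachable z (vert (gate z))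

/-- In a cactus, deleting the edges of a cycle disconnects the vertices of that cycle. -/
theorem IsCactus.not_reachable_deleteEdges (h : G.IsCactus) {x : V} {p : G.Walk x x}
    (hp : p.IsCycle) {i j : ℕ} (hij : i < j) (hj : j < p.length) :
    ¬ (G.deleteEdges p.toSubgraph.edgeSet).Reachable (p.getVert i) (p.getVert j) := by
  intro hr
  have h3 := hp.three_le_length
  have hne : ∀ k l, k < p.length → l < p.length →
      s(p.getVert k, p.getVert (k + 1)) = s(p.getVert l, p.getVert (l + 1)) → k = l := by
    intro k l hk hl hkl
    have inj0 : ∀ a b, a < p.length → b < p.length → p.getVert a = p.getVert b → a = b := by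
      intro a b ha hb hab
      exact hp.getVert_injOn' (by simp; omega) (by simp; omega) hab
    have inj1 : ∀ a b, a < p.length → b < p.length →
        p.getVert (a + 1) = p.getVert (b + 1) → a = b := by
      intro a b ha hb hab
      have := hp.getVert_injOn (x₁ := a + 1) (x₂ := b + 1)
        (by simp; omega) (by simp; omega) hab
      omega
    rcases Sym2.eq_iff.1 hkl with ⟨h1, -⟩ | ⟨h1, h2⟩
    · exact inj0 _ _ hk hl h1
    · by_cases hl' : l + 1 = p.length
      · by_cases hk' : k + 1 = p.length
        · omega
        · have := inj0 _ _ (by omega) hl h2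
          have e : p.getVert (l + 1) = p.getVert 0 := by rw [hl']; simp
          have := inj0 _ _ hk (by omega) (h1.trans e)
          omega
      · have := inj0 _ _ hk (by omega) h1
        by_cases hk' : k + 1 = p.length
        · have e : p.getVert (k + 1) = p.getVert 0 := by rw [hk']; simp
          have := inj0 _ _ (by omega) hl (e.symm.trans h2)
          omega
        · have := inj0 _ _ (by omega) hl h2
          omega
  have hmem : ∀ k < p.length, s(p.getVert k, p.getVert (k + 1)) ∈ p.toSubgraph.edgeSet := by
    intro k hk
    rw [Subgraph.mem_edgeSet]
    exact p.toSubgraph_adj_getVert hk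
  set e := s(p.getVert i, p.getVert (i + 1)) with he
  set e' := s(p.getVert j, p.getVert (j + 1)) with he'
  have hee' : e ≠ e' := fun h => by
    have := hne i j (by omega) hj h
    omega
  -- A path from `i` to `j` off the cycle, closed up by the arc from `j` back to `i + 1`, puts `e`
  -- on a cycle of `H`. That cycle shares `e` with `p` but misses `e'`.
  set H := G.deleteEdges {e'} with hH
  have arc : ∀ k, i + 1 + k ≤ j →
      (H.deleteEdges {e}).Reachable (p.getVert (i + 1)) (p.getVert (i + 1 + k)) := by
    intro k
    induction k with
    | zero => intro _; exact Reachable.refl _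
    | succ k ih =>
      intro hk
      refine (ih (by omega)).trans (Adj.reachable ?_)
      rw [deleteEdges_adj, hH, deleteEdges_adj]
      refine ⟨⟨p.adj_getVert_succ (by omega), ?_⟩, ?_⟩
      · intro h
        have := hne (i + 1 + k) j (by omega) hj h
        omega
      · intro h
        have := hne (i + 1 + k) i (by omega) (by omega) h
        omega
  have harc := arc (j - (i + 1)) (by omega)
  rw [show i + 1 + (j - (i + 1)) = j by omega] at harc
  have hr' : (H.deleteEdges {e}).Reachable (p.getVert i) (p.getVert j) := by
    refine hr.mono ?_
    intro a b hab
    rw [deleteEdges_adj] at hab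
    rw [deleteEdges_adj, hH, deleteEdges_adj]
    refine ⟨⟨hab.1, ?_⟩, ?_⟩
    · intro h
      rw [Set.mem_singleton_iff] at h
      exact hab.2 (h ▸ hmem j hj)
    · intro h
      rw [Set.mem_singleton_iff] at h
      exact hab.2 (h ▸ hmem i (by omega))
  have hadj : H.Adj (p.getVert i) (p.getVert (i + 1)) := by
    rw [hH, deleteEdges_adj]
    exact ⟨p.adj_getVert_succ (by omega), hee'⟩
  obtain ⟨u, q, hq, hqe⟩ := adj_and_reachable_delete_edges_iff_exists_cycle.1
    ⟨hadj, hr'.trans harc.symm⟩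
  have hle : H ≤ G := deleteEdges_le _
  have hqe' : e ∈ (q.mapLe hle).toSubgraph.edgeSet := by
    rw [Walk.mem_edges_toSubgraph, Walk.edges_mapLe_eq_edges]
    exact hqe
  have hqn : e' ∉ (q.mapLe hle).toSubgraph.edgeSet := by
    rw [Walk.mem_edges_toSubgraph, Walk.edges_mapLe_eq_edges]
    intro h
    have := q.edges_subset_edgeSet h
    rw [hH, edgeSet_deleteEdges] at this
    exact this.2 rfl
  have hd := h.2 (x := p.toSubgraph) ⟨x, p, hp, rfl⟩ (y := (q.mapLe hle).toSubgraph)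
    ⟨u, _, hq.mapLe hle, rfl⟩ (fun h => hqn (h ▸ hmem j hj))
  exact Set.disjoint_left.1 hd (hmem i (by omega)) hqe'

/-- A walk towards the cycle, stopped where it first uses an edge of it, ends at a gate;
`IsCactus.not_reachable_deleteEdges` makes the gate unique. Rotating the closed walk lets any vertex
be number `0`. -/
theorem IsCactus.exists_cycleCoords (h : G.IsCactus) {C : G.Subgraph} (hC : C ∈ G.cycles) {x : V}
    (hx : x ∈ C.verts) : ∃ K : CycleCoords G C, K.vert 0 = x := by
  classical
  obtain ⟨v, p', hp', rfl⟩ := hC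
  have hxs : x ∈ p'.support := by simpa using hx
  obtain ⟨p, hp, hpp⟩ : ∃ p : G.Walk x x, p.IsCycle ∧ p.toSubgraph = p'.toSubgraph :=
    ⟨p'.rotate x hxs, hp'.rotate hxs, p'.toSubgraph_rotate hxs⟩
  rw [← hpp]
  have h3 := hp.three_le_length
  have hedge : ∀ e, e ∈ p.toSubgraph.edgeSet ↔
      ∃ i < p.length, e = s(p.getVert i, p.getVert (i + 1)) := by
    intro e
    induction e with
    | _ a b =>
      rw [Subgraph.mem_edgeSet, Walk.toSubgraph_adj_iff]
      constructor
      · rintro ⟨i, h1, h2⟩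
        exact ⟨i, h2, h1.symm⟩
      · rintro ⟨i, h1, h2⟩
        exact ⟨i, h2.symm, h1⟩
  have hvert : ∀ z, z ∈ p.toSubgraph.verts ↔ ∃ i < p.length, z = p.getVert i := by
    intro z
    rw [Walk.mem_verts_toSubgraph, Walk.mem_support_iff_exists_getVert]
    constructor
    · rintro ⟨i, h1, h2⟩
      rcases h2.lt_or_eq with h2 | h2
      · exact ⟨i, h2, h1.symm⟩
      · exact ⟨0, by omega, by rw [← h1, h2]; simp⟩
    · rintro ⟨i, h1, h2⟩
      exact ⟨i, h2.symm, h1.le⟩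
  have hex : ∀ z w (q : G.Walk z w), w ∈ p.toSubgraph.verts → ∃ i < p.length,
      (G.deleteEdges p.toSubgraph.edgeSet).Reachable z (p.getVert i) := by
    intro z w q hw
    induction q with
    | nil =>
      obtain ⟨i, hi, rfl⟩ := (hvert _).1 hw
      exact ⟨i, hi, Reachable.refl _⟩
    | @cons a b _ hab q ih =>
      by_cases hm : s(a, b) ∈ p.toSubgraph.edgeSet
      · obtain ⟨i, hi, hia⟩ := (hvert a).1 (p.toSubgraph.edge_vert hm)
        exact ⟨i, hi, hia ▸ Reachable.refl _⟩
      · obtain ⟨i, hi, hr⟩ := ih hw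
        exact ⟨i, hi, (Adj.reachable (deleteEdges_adj.2 ⟨hab, hm⟩)).trans hr⟩
  have huniq : ∀ i j, i < p.length → j < p.length →
      (G.deleteEdges p.toSubgraph.edgeSet).Reachable (p.getVert i) (p.getVert j) → i = j := by
    intro i j hi hj hr
    rcases lt_trichotomy i j with hl | hl | hl
    · exact (h.not_reachable_deleteEdges hp hl hj hr).elim
    · exact hl
    · exact (h.not_reachable_deleteEdges hp hl hi hr.symm).elim
  choose γ hγ1 hγ2 using fun z => hex z x (h.1.preconnected z x).some (by simp)
  exact ⟨{ n := p.length
           vert := p.getVert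
           gate := γ
           three_le := h3
           vert_n := by simp
           adj_vert := fun i hi => p.adj_getVert_succ hi
           mem_verts := hvert
           mem_edgeSet := hedge
           gate_lt := hγ1
           gate_vert := fun i hi => huniq _ _ (hγ1 _) hi (hγ2 _).symm
           gate_eq_of_adj := fun z w hzw hm => huniq _ _ (hγ1 _) (hγ1 _) ((hγ2 z).symm.trans
             ((Adj.reachable (deleteEdges_adj.2 ⟨hzw, hm⟩)).trans (hγ2 w)))
           reachable_gate := hγ2 }, by simp⟩

namespace CycleCoords

variable {C D : G.Subgraph} (K : CycleCoords G C)

theorem vert_mem {i : ℕ} (hi : i < K.n) : K.vert i ∈ C.verts :=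
  (K.mem_verts _).2 ⟨i, hi, rfl⟩

theorem vert_gate {z : V} (hz : z ∈ C.verts) : K.vert (K.gate z) = z := by
  obtain ⟨i, hi, rfl⟩ := (K.mem_verts z).1 hz
  rw [K.gate_vert i hi]

theorem gate_eq_of_reachable {z w : V} (h : (G.deleteEdges C.edgeSet).Reachable z w) :
    K.gate z = K.gate w := by
  obtain ⟨q⟩ := h
  induction q with
  | nil => rfl
  | cons hab _ ih =>
    rw [deleteEdges_adj] at hab
    exact (K.gate_eq_of_adj _ _ hab.1 hab.2).trans ih

/-- A cycle edge-disjoint from `C` hangs at a single vertex of `C`. -/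
theorem gate_eq_of_disjoint (L : CycleCoords G D) (h : Disjoint C.edgeSet D.edgeSet) {z w : V}
    (hz : z ∈ D.verts) (hw : w ∈ D.verts) : K.gate z = K.gate w := by
  have key : ∀ i, i < L.n → K.gate (L.vert i) = K.gate (L.vert 0) := by
    intro i
    induction i with
    | zero => intro _; rfl
    | succ i ih =>
      intro hi
      rw [← ih (by omega)]
      exact (K.gate_eq_of_adj _ _ (L.adj_vert i (by omega)) (Set.disjoint_right.1 h
        ((L.mem_edgeSet _).2 ⟨i, by omega, rfl⟩))).symm
  obtain ⟨i, hi, rfl⟩ := (L.mem_verts z).1 hz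
  obtain ⟨j, hj, rfl⟩ := (L.mem_verts w).1 hw
  rw [key i hi, key j hj]

end CycleCoords

/-- The coordinates of a cycle may start at the vertex where another cycle hangs. -/
theorem IsCactus.exists_cycleCoords_gate (h : G.IsCactus) {C D : G.Subgraph} (hC : C ∈ G.cycles)
    (hD : D ∈ G.cycles) (hCD : C ≠ D) :
    ∃ K : CycleCoords G C, ∀ z ∈ D.verts, K.gate z = 0 := by
  obtain ⟨x, hx⟩ : C.verts.Nonempty := by
    obtain ⟨v, p, -, rfl⟩ := hC
    exact ⟨v, by simp⟩
  obtain ⟨d, hd⟩ : D.verts.Nonempty := by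
    obtain ⟨v, p, -, rfl⟩ := hD
    exact ⟨v, by simp⟩
  obtain ⟨K, -⟩ := h.exists_cycleCoords hC hx
  obtain ⟨L, -⟩ := h.exists_cycleCoords hD hd
  -- `K` has an arbitrary origin and only serves to find where `D` hangs; `K'` starts there.
  obtain ⟨K', hK'⟩ := h.exists_cycleCoords hC (K.vert_mem (K.gate_lt d))
  refine ⟨K', fun z hz => ?_⟩
  rw [K'.gate_eq_of_disjoint L (h.2 hC hD hCD) hz hd,
    K'.gate_eq_of_reachable (K.reachable_gate d), ← hK']
  exact K'.gate_vert 0 (by have := K'.three_le; omega)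

/-! ### Distances through a cycle -/

/-- The distance between the vertex `k` and the edge from `i` to `i + 1` in a cycle of
length `n`. -/
def cycEdgeDist (n k i : ℕ) : ℕ :=
  min (cycDist n k i) (cycDist n k (if i + 1 = n then 0 else i + 1))

theorem edgeDist_mk (s a b : V) : G.edgeDist s s(a, b) = min (G.dist s a) (G.dist s b) := rfl

theorem Connected.edgeDist_le (h : G.Connected) (s v : V) (e : Sym2 V) :
    G.edgeDist s e ≤ G.dist s v + G.edgeDist v e := by
  induction e with
  | _ a b =>
    have := h.dist_triangle (u := s) (v := v) (w := a)
    have := h.dist_triangle (u := s) (v := v) (w := b)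
    simp only [edgeDist_mk]
    omega

namespace CycleCoords

variable {C D : G.Subgraph} (K : CycleCoords G C)

theorem dist_vert_le (hG : G.Connected) {i j : ℕ} (hi : i < K.n) (hj : j < K.n) :
    G.dist (K.vert i) (K.vert j) ≤ cycDist K.n i j := by
  have arc : ∀ i k, i + k ≤ K.n → G.dist (K.vert i) (K.vert (i + k)) ≤ k := by
    intro i k
    induction k with
    | zero => intro _; simp
    | succ k ih =>
      intro hk
      obtain ⟨q, hq⟩ := (Reachable.exists_walk_length_eq_dist (G := G)
        (u := K.vert i) (v := K.vert (i + k)) (hG.preconnected _ _))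
      have h1 := dist_le (q.concat (K.adj_vert (i + k) (by omega)))
      have := ih (by omega)
      rw [Walk.length_concat] at h1
      exact h1.trans (by omega)
  have key : ∀ i j, i ≤ j → j < K.n → G.dist (K.vert i) (K.vert j) ≤ cycDist K.n i j := by
    intro i j hij hj
    have h1 := arc i (j - i) (by omega)
    have h2 := arc 0 i (by omega)
    have h3 := arc j (K.n - j) (by omega)
    rw [show i + (j - i) = j by omega] at h1
    rw [zero_add] at h2
    rw [show j + (K.n - j) = K.n by omega, K.vert_n] at h3
    have h4 := hG.dist_triangle (u := K.vert j) (v := K.vert 0) (w := K.vert i)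
    rw [G.dist_comm (u := K.vert j) (v := K.vert i)] at h4
    unfold cycDist
    omega
  rcases le_total i j with h | h
  · exact key i j h hj
  · rw [dist_comm]
    refine (key j i h hi).trans (le_of_eq ?_)
    unfold cycDist
    omega

/-- An edge joining vertices hanging at different vertices of `C` belongs to `C`. -/
theorem of_adj_of_gate_ne {z w : V} (h : G.Adj z w) (hne : K.gate z ≠ K.gate w) :
    z ∈ C.verts ∧ w ∈ C.verts ∧ cycDist K.n (K.gate z) (K.gate w) ≤ 1 := by
  have hm : s(z, w) ∈ C.edgeSet := by
    by_contra hm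
    exact hne (K.gate_eq_of_adj z w h hm)
  refine ⟨C.edge_vert hm, C.edge_vert (C.adj_symm hm), ?_⟩
  have h3 := K.three_le
  obtain ⟨i, hi, he⟩ := (K.mem_edgeSet _).1 hm
  have hg : K.gate (K.vert (i + 1)) = if i + 1 = K.n then 0 else i + 1 := by
    split_ifs with hin
    · rw [hin, K.vert_n, K.gate_vert 0 (by omega)]
    · exact K.gate_vert _ (by omega)
  rcases Sym2.eq_iff.1 he with ⟨rfl, rfl⟩ | ⟨rfl, rfl⟩
  · rw [hg, K.gate_vert i hi]
    unfold cycDist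
    split_ifs <;> omega
  · rw [hg, K.gate_vert i hi]
    unfold cycDist
    split_ifs <;> omega

/-- Induction on the walk: a step that keeps the gate changes the distance to it by at most one, and
a step that changes the gate runs along `C`. -/
theorem le_length (hG : G.Connected) {z w : V} (q : G.Walk z w) (h : K.gate z ≠ K.gate w) :
    G.dist z (K.vert (K.gate z)) + cycDist K.n (K.gate z) (K.gate w) +
      G.dist (K.vert (K.gate w)) w ≤ q.length := by
  induction q with
  | nil => exact (h rfl).elim
  | @cons a b c hab q ih =>
    rw [Walk.length_cons]
    by_cases hg : K.gate a = K.gate b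
    · rw [hg] at h ⊢
      have h1 := ih h
      have h2 := hG.dist_triangle (u := a) (v := b) (w := K.vert (K.gate b))
      have h3 := dist_le (Walk.cons hab Walk.nil)
      simp only [Walk.length_cons, Walk.length_nil] at h3
      omega
    · obtain ⟨ha, hb, h1⟩ := K.of_adj_of_gate_ne hab hg
      rw [K.vert_gate ha, dist_self]
      by_cases hg' : K.gate b = K.gate c
      · rw [← hg', K.vert_gate hb]
        have := dist_le q
        omega
      · have h2 := ih hg'
        have ha := K.gate_lt a
        have hb := K.gate_lt b
        have hc := K.gate_lt c
        have h3 : cycDist K.n (K.gate a) (K.gate c) ≤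
            cycDist K.n (K.gate a) (K.gate b) + cycDist K.n (K.gate b) (K.gate c) := by
          unfold cycDist
          omega
        omega

theorem dist_eq (hG : G.Connected) {z w : V} (h : K.gate z ≠ K.gate w) :
    G.dist z w = G.dist z (K.vert (K.gate z)) + cycDist K.n (K.gate z) (K.gate w) +
      G.dist (K.vert (K.gate w)) w := by
  obtain ⟨q, hq⟩ := hG.exists_walk_length_eq_dist z w
  have h1 := K.le_length hG q h
  have h2 := K.dist_vert_le hG (K.gate_lt z) (K.gate_lt w)
  have h3 := hG.dist_triangle (u := z) (v := K.vert (K.gate z)) (w := w)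
  have h4 := hG.dist_triangle (u := K.vert (K.gate z)) (v := K.vert (K.gate w)) (w := w)
  omega

theorem cycDist_self (n i : ℕ) : cycDist n i i = 0 := by
  simp [cycDist]

theorem dist_vert (hG : G.Connected) {i : ℕ} (hi : i < K.n) (w : V) :
    G.dist (K.vert i) w = cycDist K.n i (K.gate w) + G.dist (K.vert (K.gate w)) w := by
  by_cases h : i = K.gate w
  · rw [← h, cycDist_self, zero_add]
  · have := K.dist_eq hG (z := K.vert i) (w := w) (by rwa [K.gate_vert i hi])
    rwa [K.gate_vert i hi, dist_self, zero_add] at this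

theorem dist_to_vert (hG : G.Connected) (s : V) {i : ℕ} (hi : i < K.n) :
    G.dist s (K.vert i) = G.dist s (K.vert (K.gate s)) + cycDist K.n (K.gate s) i := by
  have := K.dist_vert hG hi s
  rw [dist_comm, this, add_comm, dist_comm]
  congr 1
  unfold cycDist
  omega

/-- The distance from a vertex to an edge of the cycle. -/
theorem edgeDist_edge (hG : G.Connected) (s : V) {i : ℕ} (hi : i < K.n) :
    G.edgeDist s s(K.vert i, K.vert (i + 1)) =
      G.dist s (K.vert (K.gate s)) + cycEdgeDist K.n (K.gate s) i := by
  have h3 := K.three_le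
  have h1 : G.dist s (K.vert (i + 1)) = G.dist s (K.vert (K.gate s)) +
      cycDist K.n (K.gate s) (if i + 1 = K.n then 0 else i + 1) := by
    split_ifs with h
    · rw [h, K.vert_n, K.dist_to_vert hG s (by omega)]
    · rw [K.dist_to_vert hG s (by omega)]
  rw [edgeDist_mk, h1, K.dist_to_vert hG s hi, cycEdgeDist]
  omega

theorem edgeDist_vert_edge (hG : G.Connected) {k i : ℕ} (hk : k < K.n) (hi : i < K.n) :
    G.edgeDist (K.vert k) s(K.vert i, K.vert (i + 1)) = cycEdgeDist K.n k i := by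
  rw [K.edgeDist_edge hG _ hi, K.gate_vert k hk, dist_self, zero_add]

/-- The distance from a vertex to an edge hanging at a different vertex of the cycle. -/
theorem edgeDist_of_gate_ne (hG : G.Connected) (s : V) {k : ℕ} {f : Sym2 V}
    (hf : ∀ z ∈ f, K.gate z = k) (hs : K.gate s ≠ k) :
    G.edgeDist s f = G.dist s (K.vert (K.gate s)) + cycDist K.n (K.gate s) k +
      G.edgeDist (K.vert k) f := by
  induction f with
  | _ a b =>
    have ha := hf a (by simp)
    have hb := hf b (by simp)
    have h1 := K.dist_eq hG (z := s) (w := a) (by rwa [ha])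
    have h2 := K.dist_eq hG (z := s) (w := b) (by rwa [hb])
    rw [ha] at h1
    rw [hb] at h2
    simp only [edgeDist_mk]
    omega

theorem edgeDist_vert_of_gate (hG : G.Connected) {i k : ℕ} {f : Sym2 V} (hi : i < K.n)
    (hf : ∀ z ∈ f, K.gate z = k) :
    G.edgeDist (K.vert i) f = cycDist K.n i k + G.edgeDist (K.vert k) f := by
  induction f with
  | _ a b =>
    have ha := hf a (by simp)
    have hb := hf b (by simp)
    have h1 := K.dist_vert hG hi a
    have h2 := K.dist_vert hG hi b
    rw [ha] at h1
    rw [hb] at h2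
    simp only [edgeDist_mk]
    omega

/-! ### Arithmetic of edge distances on a cycle -/

theorem cycEdgeDist_zero {n i : ℕ} (hn : 3 ≤ n) (hi : i < n) :
    cycEdgeDist n 0 i = min i (n - 1 - i) := by
  unfold cycEdgeDist cycDist
  split_ifs <;> omega

theorem cycEdgeDist_one {n i : ℕ} (hn : 3 ≤ n) (hi : i < n) :
    cycEdgeDist n 1 i = min (i - 1) (n - i) := by
  unfold cycEdgeDist cycDist
  split_ifs <;> omega

/-- Truncated subtraction leaves one nonzero term at most, according to the side of `⌈n/2⌉` on which
edge `i` lies. -/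
theorem cycEdgeDist_half {n i : ℕ} (hn : 3 ≤ n) (hi : i < n) :
    cycEdgeDist n ((n + 1) / 2) i = (i - (n + 1) / 2) + ((n + 1) / 2 - 1 - i) := by
  obtain ⟨m, hm⟩ : ∃ m, (n + 1) / 2 = m := ⟨_, rfl⟩
  have h1 : 2 * m = n ∨ 2 * m = n + 1 := by omega
  rw [hm]
  unfold cycEdgeDist cycDist
  split_ifs <;> omega

/-- Vertex `0` confuses edge `i` only with its mirror image `n - 1 - i`; vertex `1` tells these
apart. -/
theorem cycEdgeDist_inj {n i j : ℕ} (hn : 3 ≤ n) (hi : i < n) (hj : j < n)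
    (h0 : cycEdgeDist n 0 i = cycEdgeDist n 0 j) (h1 : cycEdgeDist n 1 i = cycEdgeDist n 1 j) :
    i = j := by
  rw [cycEdgeDist_zero hn hi, cycEdgeDist_zero hn hj] at h0
  rw [cycEdgeDist_one hn hi, cycEdgeDist_one hn hj] at h1
  omega

/-- Vertices `0`, `1` and about `n / 2` of a cycle do not see an edge of the cycle behind
another vertex. -/
theorem cycEdgeDist_ne_add {n i k t : ℕ} (hn : 3 ≤ n) (hi : i < n) (hk : k < n)
    (h0 : k ≠ 0 → cycEdgeDist n 0 i = cycDist n 0 k + t)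
    (h1 : cycEdgeDist n 1 i = cycDist n 1 k + t)
    (h2 : cycEdgeDist n ((n + 1) / 2) i = cycDist n ((n + 1) / 2) k + t) : False := by
  rw [cycEdgeDist_zero hn hi] at h0
  rw [cycEdgeDist_one hn hi] at h1
  rw [cycEdgeDist_half hn hi] at h2
  obtain ⟨m, hm⟩ : ∃ m, (n + 1) / 2 = m := ⟨_, rfl⟩
  have hmn : 2 * m = n ∨ 2 * m = n + 1 := by omega
  rw [hm] at h2
  clear hm
  unfold cycDist at h0 h1 h2
  by_cases hk0 : k = 0
  -- No edge is farther than `m - 1` from vertex `m`, so `h2` forces `n` odd, `t = 0` and `i = 0`,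
  -- contradicting `h1`.
  · subst hk0
    clear h0
    omega
  · have h0 := h0 hk0
    rcases le_total k m with hkm | hkm
    · rw [show m - k + (k - m) = m - k by omega] at h2
      omega
    · rw [show m - k + (k - m) = k - m by omega] at h2
      omega

end CycleCoords

/-! ### Bridges -/

/-- In a finite graph without leaves there is a cycle on each side of a bridge. -/
theorem exists_cycle_of_isBridge [Finite V] (hleaf : ∀ v, ¬ ∃! w, G.Adj v w) {a b : V}
    (hab : G.Adj a b) (hbr : ¬ (G.deleteEdges {s(a, b)}).Reachable a b) :
    ∃ C ∈ G.cycles, ∀ z ∈ C.verts, (G.deleteEdges {s(a, b)}).Reachable z b := by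
  classical
  have := Fintype.ofFinite V
  set H := G.deleteEdges {s(a, b)} with hH
  set c := H.connectedComponentMk b with hc
  have hmem : ∀ z, z ∈ c ↔ H.Reachable z b := fun z => by
    rw [hc, ← SetLike.mem_coe]
    exact ConnectedComponent.eq
  by_cases hac : c.toSimpleGraph.IsAcyclic
  · exfalso
    have htree : c.toSimpleGraph.IsTree := ⟨c.connected_toSimpleGraph, hac⟩
    have hbc : b ∈ c := (hmem b).2 (Reachable.refl _)
    obtain ⟨w, hbw, hwa⟩ : ∃ w, G.Adj b w ∧ w ≠ a := by
      by_contra! hcon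
      exact hleaf b ⟨a, hab.symm, fun w hw => hcon w hw⟩
    have hHbw : H.Adj b w := by
      rw [hH, deleteEdges_adj]
      refine ⟨hbw, fun h => ?_⟩
      rcases Sym2.eq_iff.1 h with ⟨h1, h2⟩ | ⟨h1, h2⟩
      · exact hab.ne h1.symm
      · exact hwa h2
    have hwc : w ∈ c := (hmem w).2 hHbw.symm.reachable
    have hnt : Nontrivial c := ⟨⟨b, hbc⟩, ⟨w, hwc⟩, fun h => hbw.ne (congrArg Subtype.val h)⟩
    have key : ∀ u : c, u.1 ≠ b → c.toSimpleGraph.degree u ≠ 1 := by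
      intro u hub hdeg
      obtain ⟨w, hw, huniq⟩ := degree_eq_one_iff_existsUnique_adj.1 hdeg
      have hua : u.1 ≠ a := fun h => hbr (h ▸ (hmem u.1).1 u.2)
      have hadj : ∀ y, G.Adj u.1 y → H.Adj u.1 y := fun y hy => by
        refine deleteEdges_adj.2 ⟨hy, fun h => ?_⟩
        rcases Sym2.eq_iff.1 h with ⟨h1, -⟩ | ⟨h1, -⟩
        · exact hua h1
        · exact hub h1
      refine hleaf u.1 ⟨w.1, (deleteEdges_le {s(a, b)} : H ≤ G)
        (c.toSimpleGraph_hom.map_adj hw), fun y hy => ?_⟩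
      · have hyc : y ∈ c := (hmem y).2 ((hadj y hy).symm.reachable.trans ((hmem u.1).1 u.2))
        exact congrArg Subtype.val (huniq ⟨y, hyc⟩ ((c.toSimpleGraph_adj u.2 hyc).2 (hadj y hy)))
    -- A nontrivial tree has two leaves. One of them is not `b`, so it loses no edge with the bridge
    -- and is a leaf of `G`.
    obtain ⟨u, v, huv, hu, hv⟩ := htree.exists_ne_and_degree_eq_one
    by_cases hub : u.1 = b
    · refine key v (fun hvb => huv (Subtype.ext (hub.trans hvb.symm))) ?_
      convert hv
    · refine key u hub ?_
      convert hu
  · unfold IsAcyclic at hac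
    push Not at hac
    obtain ⟨v, q, hq⟩ := hac
    have hinj : Function.Injective c.toSimpleGraph_hom := Subtype.val_injective
    have hle : H ≤ G := deleteEdges_le _
    refine ⟨((q.map c.toSimpleGraph_hom).mapLe hle).toSubgraph,
      ⟨_, _, (hq.map hinj).mapLe hle, rfl⟩, fun z hz => ?_⟩
    rw [Walk.mem_verts_toSubgraph, Walk.support_mapLe_eq_support, Walk.support_map,
      List.mem_map] at hz
    obtain ⟨y, -, rfl⟩ := hz
    exact (hmem _).1 y.2

theorem Connected.reachable_deleteEdges_or (h : G.Connected) (a b z : V) :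
    (G.deleteEdges {s(a, b)}).Reachable z a ∨ (G.deleteEdges {s(a, b)}).Reachable z b := by
  obtain ⟨q⟩ := h.preconnected z a
  suffices ∀ z w (q : G.Walk z w), w = a → (G.deleteEdges {s(a, b)}).Reachable z a ∨
      (G.deleteEdges {s(a, b)}).Reachable z b from this z a q rfl
  intro z w q hw
  induction q with
  | nil => exact Or.inl (hw ▸ Reachable.refl _)
  | @cons x y _ hxy q ih =>
    by_cases he : s(x, y) = s(a, b)
    · rcases Sym2.eq_iff.1 he with ⟨rfl, -⟩ | ⟨rfl, -⟩
      · exact Or.inl (Reachable.refl _)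
      · exact Or.inr (Reachable.refl _)
    · have hr : (G.deleteEdges {s(a, b)}).Reachable x y :=
        (deleteEdges_adj.2 ⟨hxy, he⟩ : (G.deleteEdges {s(a, b)}).Adj x y).reachable
      exact (ih hw).imp hr.trans hr.trans

/-- A walk to the other side has to pass through `b` and then cross the bridge. -/
theorem Connected.dist_lt_of_isBridge (h : G.Connected) {a b s z : V}
    (hbr : ¬ (G.deleteEdges {s(a, b)}).Reachable a b)
    (hs : (G.deleteEdges {s(a, b)}).Reachable s b)
    (hz : (G.deleteEdges {s(a, b)}).Reachable z a) : G.dist s b < G.dist s z := by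
  obtain ⟨q, hq⟩ := h.exists_walk_length_eq_dist s z
  rw [← hq]
  clear hq
  induction q with
  | nil => exact (hbr (hz.symm.trans hs)).elim
  | @cons x y _ hxy q ih =>
    rw [Walk.length_cons]
    by_cases he : s(x, y) = s(a, b)
    · rcases Sym2.eq_iff.1 he with ⟨rfl, -⟩ | ⟨rfl, -⟩
      · exact (hbr hs).elim
      · simp
    · have hr : (G.deleteEdges {s(a, b)}).Reachable x y :=
        (deleteEdges_adj.2 ⟨hxy, he⟩ : (G.deleteEdges {s(a, b)}).Adj x y).reachable
      have h1 := ih (hr.symm.trans hs) hz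
      have h2 := h.dist_triangle (u := x) (v := y) (w := b)
      have h3 := dist_le (Walk.cons hxy Walk.nil)
      simp only [Walk.length_cons, Walk.length_nil] at h3
      omega

theorem not_reachable_of_notMem_cycles {a b : V} (hab : G.Adj a b)
    (h : ∀ C ∈ G.cycles, s(a, b) ∉ C.edgeSet) : ¬ (G.deleteEdges {s(a, b)}).Reachable a b := by
  intro hr
  obtain ⟨u, p, hp, hm⟩ := adj_and_reachable_delete_edges_iff_exists_cycle.1 ⟨hab, hr⟩
  exact h _ ⟨u, p, hp, rfl⟩ (p.mem_edges_toSubgraph.2 hm)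

/-- An edge outside all cycles is distinguished from any other edge by every set that meets all
cycles. -/
theorem Connected.exists_edgeDist_ne_of_notMem_cycles [Finite V] (hG : G.Connected)
    (hleaf : ∀ v, ¬ ∃! w, G.Adj v w) {S : Finset V} (hS : ∀ C ∈ G.cycles, ∃ s ∈ S, s ∈ C.verts)
    {e f : Sym2 V} (he : e ∈ G.edgeSet) (hf : f ∈ G.edgeSet) (hef : e ≠ f)
    (hcyc : ∀ C ∈ G.cycles, e ∉ C.edgeSet) : ∃ s ∈ S, G.edgeDist s e ≠ G.edgeDist s f := by
  -- If `uv` lies on the side of `a`, an element of `S` on a cycle beyond `b` is nearer to `b` than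
  -- to `u` and `v`.
  have main : ∀ a b u v, G.Adj a b → ¬ (G.deleteEdges {s(a, b)}).Reachable a b →
      (G.deleteEdges {s(a, b)}).Reachable u v → (G.deleteEdges {s(a, b)}).Reachable u a →
      ∃ s ∈ S, G.edgeDist s s(a, b) ≠ G.edgeDist s s(u, v) := by
    intro a b u v hab hbr huv hua
    obtain ⟨C, hC, hCb⟩ := exists_cycle_of_isBridge hleaf hab hbr
    obtain ⟨s, hs, hsC⟩ := hS C hC
    refine ⟨s, hs, ?_⟩
    have h1 := hG.dist_lt_of_isBridge hbr (hCb s hsC) hua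
    have h2 := hG.dist_lt_of_isBridge hbr (hCb s hsC) (huv.symm.trans hua)
    simp only [edgeDist_mk]
    omega
  induction e with
  | _ a b =>
  induction f with
  | _ u v =>
    have hbr := not_reachable_of_notMem_cycles he hcyc
    have huv : (G.deleteEdges {s(a, b)}).Reachable u v :=
      (deleteEdges_adj.2 ⟨hf, fun h => hef h.symm⟩ : (G.deleteEdges {s(a, b)}).Adj u v).reachable
    rcases hG.reachable_deleteEdges_or a b u with hu | hu
    · exact main a b u v he hbr huv hu
    · have := main b a u v
      rw [Sym2.eq_swap (a := b)] at this
      exact this he.symm (fun h => hbr h.symm) huv hu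

/-! ### Construction of generators -/

theorem mem_verts_of_mem_edge {D : G.Subgraph} {e : Sym2 V} (he : e ∈ D.edgeSet) {z : V}
    (hz : z ∈ e) : z ∈ D.verts := by
  induction e with
  | _ a b =>
    rcases Sym2.mem_iff.1 hz with rfl | rfl
    · exact D.edge_vert he
    · exact D.edge_vert (D.adj_symm he)

/-- Edges of two cycles are distinguished if the first cycle contains a suitable geodesic triple
of vertices at which elements of `S` hang. -/
theorem CycleCoords.not_forall_edgeDist_eq {C D : G.Subgraph} (hG : G.Connected)
    (K : CycleCoords G C) (L : CycleCoords G D) (hCD : Disjoint C.edgeSet D.edgeSet) {S : Finset V}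
    (h0 : ∃ s ∈ S, K.gate s = 0) (h1 : K.vert 1 ∈ S) (hm : K.vert ((K.n + 1) / 2) ∈ S)
    {e f : Sym2 V} (he : e ∈ C.edgeSet) (hf : f ∈ D.edgeSet) :
    ¬ ∀ s ∈ S, G.edgeDist s e = G.edgeDist s f := by
  intro hS
  have h3 := K.three_le
  obtain ⟨i, hi, rfl⟩ := (K.mem_edgeSet e).1 he
  have hgate : ∀ z ∈ f, K.gate z = K.gate (L.vert 0) := fun z hz =>
    K.gate_eq_of_disjoint L hCD (mem_verts_of_mem_edge hf hz)
      (L.vert_mem (by have := L.three_le; omega))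
  refine cycEdgeDist_ne_add (t := G.edgeDist (K.vert (K.gate (L.vert 0))) f)
    h3 hi (K.gate_lt (L.vert 0)) ?_ ?_ ?_
  -- For gate `0`, `s` and `f` hang at the same vertex and the distance does not split.
  · intro hk
    obtain ⟨s, hs, hs0⟩ := h0
    have := hS s hs
    rw [K.edgeDist_edge hG s hi, K.edgeDist_of_gate_ne hG s hgate (by rw [hs0]; exact hk.symm),
      hs0] at this
    omega
  · have := hS _ h1
    rwa [K.edgeDist_vert_edge hG (by omega) hi, K.edgeDist_vert_of_gate hG (by omega) hgate]
      at this
  · have := hS _ hm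
    rwa [K.edgeDist_vert_edge hG (by omega) hi, K.edgeDist_vert_of_gate hG (by omega) hgate]
      at this

/-- If `f` hangs at vertex `0` of the cycle, and vertex `1` and a vertex hanging at vertex `0` do
not distinguish `f` from an edge `e` of the cycle, then neither does vertex `0`. -/
theorem CycleCoords.edgeDist_zero_eq {C : G.Subgraph} (hG : G.Connected) (K : CycleCoords G C)
    {S : Finset V} (h0 : ∃ s ∈ S, K.gate s = 0) (h1 : K.vert 1 ∈ S) {e f : Sym2 V}
    (he : e ∈ C.edgeSet) (hf : ∀ z ∈ f, K.gate z = 0)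
    (hS : ∀ s ∈ S, G.edgeDist s e = G.edgeDist s f) :
    G.edgeDist (K.vert 0) e = G.edgeDist (K.vert 0) f := by
  have h3 := K.three_le
  obtain ⟨i, hi, rfl⟩ := (K.mem_edgeSet e).1 he
  obtain ⟨s, hs, hs0⟩ := h0
  have e1 := hS s hs
  have e2 := hS _ h1
  -- The triangle inequality through vertex `0` gives `≤`. Vertex `1` gives `≥`: it is exactly one
  -- farther from `f` than vertex `0`, and at most one farther from `e`.
  have e3 := hG.edgeDist_le s (K.vert 0) f
  rw [K.edgeDist_edge hG s hi, hs0] at e1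
  rw [K.edgeDist_vert_edge hG (by omega) hi, K.edgeDist_vert_of_gate hG (by omega) hf] at e2
  rw [K.edgeDist_vert_edge hG (by omega) hi]
  rw [cycEdgeDist_zero h3 hi] at e1 ⊢
  rw [cycEdgeDist_one h3 hi] at e2
  have e4 : cycDist K.n 1 0 = 1 := by
    unfold cycDist
    omega
  omega

/-- Vertex `1` of `π C` hangs at vertex `0` of `C` and replaces it. Cycles in `W` lack the third
vertex, so two of them must be disjoint and face each other. -/
theorem IsCactus.isEdgeMetricGenerator [Finite V] (h : G.IsCactus)
    (hleaf : ∀ v, ¬ ∃! w, G.Adj v w) {S : Finset V} {W : Set G.cycles}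
    (K : ∀ C : G.cycles, CycleCoords G C.1) (π : G.cycles → G.cycles)
    (hK : ∀ C, ∀ z ∈ (π C).1.verts, (K C).gate z = 0) (h1 : ∀ C, (K C).vert 1 ∈ S)
    (hm : ∀ C ∉ W, (K C).vert (((K C).n + 1) / 2) ∈ S)
    (hW : ∀ C ∈ W, ∀ D ∈ W, C ≠ D → π C = D ∧ Disjoint C.1.verts D.1.verts) :
    G.IsEdgeMetricGenerator S := by
  have hlt : ∀ C, 3 ≤ (K C).n := fun C => (K C).three_le
  have h0 : ∀ C, ∃ s ∈ S, (K C).gate s = 0 := fun C =>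
    ⟨_, h1 (π C), hK C _ ((K (π C)).vert_mem (by have := hlt (π C); omega))⟩
  have hdisj : ∀ C D : G.cycles, C ≠ D → Disjoint C.1.edgeSet D.1.edgeSet := fun C D hCD =>
    h.2 C.2 D.2 (fun h => hCD (Subtype.ext h))
  intro e he f hf hef
  by_contra! hcon
  have hmeet : ∀ C ∈ G.cycles, ∃ s ∈ S, s ∈ C.verts := fun C hC =>
    ⟨_, h1 ⟨C, hC⟩, (K ⟨C, hC⟩).vert_mem (by have := hlt ⟨C, hC⟩; omega)⟩
  have hcyc : ∀ e f, e ∈ G.edgeSet → f ∈ G.edgeSet → e ≠ f →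
      (∀ s ∈ S, G.edgeDist s e = G.edgeDist s f) → ∃ C : G.cycles, e ∈ C.1.edgeSet := by
    intro e f he hf hef hcon
    by_contra! hno
    obtain ⟨s, hs, hne⟩ := h.1.exists_edgeDist_ne_of_notMem_cycles hleaf hmeet he hf hef
      (fun C hC => hno ⟨C, hC⟩)
    exact hne (hcon s hs)
  obtain ⟨C, heC⟩ := hcyc e f he hf hef hcon
  obtain ⟨D, hfD⟩ := hcyc f e hf he hef.symm (fun s hs => (hcon s hs).symm)
  by_cases hCD : C = D
  · subst hCD
    obtain ⟨i, hi, rfl⟩ := ((K C).mem_edgeSet e).1 heC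
    obtain ⟨j, hj, rfl⟩ := ((K C).mem_edgeSet f).1 hfD
    obtain ⟨s, hs, hs0⟩ := h0 C
    have e0 := hcon s hs
    have e1 := hcon _ (h1 C)
    have := hlt C
    rw [(K C).edgeDist_edge h.1 s hi, (K C).edgeDist_edge h.1 s hj, hs0] at e0
    rw [(K C).edgeDist_vert_edge h.1 (by omega) hi,
      (K C).edgeDist_vert_edge h.1 (by omega) hj] at e1
    have hij := CycleCoords.cycEdgeDist_inj (hlt C) hi hj (by omega) e1
    exact hef (by rw [hij])
  · by_cases hCW : C ∈ W
    · by_cases hDW : D ∈ W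
      -- With `p`, `q` the zero vertices of the two cycles, `d(p,e) = d(p,f) = d(p,q) + d(q,f)` and
      -- `d(q,f) = d(q,e) = d(p,q) + d(p,e)`, so `d(p,q) = 0`, against disjointness.
      · obtain ⟨rfl, hv⟩ := hW C hCW D hDW hCD
        obtain ⟨hDC, -⟩ := hW _ hDW C hCW (Ne.symm hCD)
        have hKC := hK C
        have hKD := hK (π C)
        rw [hDC] at hKD
        have hC0 : (K C).vert 0 ∈ C.1.verts := (K C).vert_mem (by have := hlt C; omega)
        have hD0 : (K (π C)).vert 0 ∈ (π C).1.verts :=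
          (K (π C)).vert_mem (by have := hlt (π C); omega)
        have e1 := (K C).edgeDist_zero_eq h.1 (h0 C) (h1 C) heC
          (fun z hz => hKC z (mem_verts_of_mem_edge hfD hz)) hcon
        have e2 := (K (π C)).edgeDist_zero_eq h.1 (h0 _) (h1 _) hfD
          (fun z hz => hKD z (mem_verts_of_mem_edge heC hz)) (fun s hs => (hcon s hs).symm)
        have key : ∀ (A B : G.cycles) (a b : Sym2 V), a ∈ A.1.edgeSet → b ∈ B.1.edgeSet →
            (∀ z ∈ B.1.verts, (K A).gate z = 0) → (∀ z ∈ A.1.verts, (K B).gate z = 0) →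
            A.1.verts ∩ B.1.verts = ∅ →
            G.edgeDist ((K A).vert 0) b =
              G.dist ((K A).vert 0) ((K B).vert 0) + G.edgeDist ((K B).vert 0) b := by
          intro A B a b ha hb hA hB hAB
          have hA0 : (K A).vert 0 ∈ A.1.verts := (K A).vert_mem (by have := hlt A; omega)
          obtain ⟨j, hj, rfl⟩ := ((K B).mem_edgeSet b).1 hb
          rw [(K B).edgeDist_edge h.1 _ hj, hB _ hA0,
            (K B).edgeDist_vert_edge h.1 (by have := hlt B; omega) hj]
        have e3 := key C (π C) e f heC hfD hKC hKD hv.inter_eq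
        have e4 := key (π C) C f e hfD heC hKD hKC hv.symm.inter_eq
        have hpos := h.1.pos_dist_of_ne (u := (K C).vert 0) (v := (K (π C)).vert 0)
          (fun h => Set.disjoint_left.1 hv hC0 (h ▸ hD0))
        rw [dist_comm] at e4
        omega
      · exact (K D).not_forall_edgeDist_eq h.1 (K C) (hdisj D C (Ne.symm hCD)) (h0 D) (h1 D)
          (hm D hDW) hfD heC (fun s hs => (hcon s hs).symm)
    · exact (K C).not_forall_edgeDist_eq h.1 (K D) (hdisj C D hCD) (h0 C) (h1 C)
          (hm C hCW) heC hfD hcon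

theorem edim_le_card {S : Finset V} (hS : G.IsEdgeMetricGenerator S) : G.edim ≤ S.card :=
  Nat.sInf_le ⟨S, hS, rfl⟩

/-- The number of vertices needed when two vertices are taken on each cycle outside `W`, and one
on each cycle in `W`. -/
theorem IsCactus.exists_isEdgeMetricGenerator [Finite V] (h : G.IsCactus)
    (hleaf : ∀ v, ¬ ∃! w, G.Adj v w) (π : G.cycles → G.cycles) (hπ : ∀ C, π C ≠ C)
    (W : Finset G.cycles)
    (hW : ∀ C ∈ W, ∀ D ∈ W, C ≠ D → π C = D ∧ Disjoint C.1.verts D.1.verts) :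
    ∃ S : Finset V, G.IsEdgeMetricGenerator S ∧ S.card + W.card ≤ 2 * G.cycles.ncard := by
  classical
  have : Fintype G.cycles := Fintype.ofFinite _
  choose K hK using fun C : G.cycles =>
    h.exists_cycleCoords_gate C.2 (π C).2 (fun e => hπ C (Subtype.ext e.symm))
  refine ⟨Finset.univ.image (fun C => (K C).vert 1) ∪
    Wᶜ.image (fun C => (K C).vert (((K C).n + 1) / 2)),
    h.isEdgeMetricGenerator hleaf (W := W) K π hK (fun C => ?_) (fun C hC => ?_) hW, ?_⟩
  · exact Finset.mem_union_left _ (Finset.mem_image_of_mem _ (Finset.mem_univ C))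
  · exact Finset.mem_union_right _ (Finset.mem_image_of_mem (fun C => (K C).vert
      (((K C).n + 1) / 2)) (Finset.mem_compl.2 (by simpa using hC)))
  · have h1 := Finset.card_union_le (Finset.univ.image (fun C => (K C).vert 1))
      (Wᶜ.image (fun C => (K C).vert (((K C).n + 1) / 2)))
    have h2 := Finset.card_image_le (s := Finset.univ) (f := fun C => (K C).vert 1)
    have h3 := Finset.card_image_le (s := Wᶜ) (f := fun C => (K C).vert (((K C).n + 1) / 2))
    have h4 := Finset.card_add_card_compl W
    have h5 : G.cycles.ncard = Fintype.card G.cycles := by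
      rw [← Nat.card_coe_set_eq, Nat.card_eq_fintype_card]
    rw [Finset.card_univ] at h2
    omega

/-! ### Pairwise intersecting cycles -/

theorem IsCactus.eq_of_mem_verts (h : G.IsCactus) {C D : G.Subgraph} (hC : C ∈ G.cycles)
    (hD : D ∈ G.cycles) (hCD : C ≠ D) {z w : V} (hzC : z ∈ C.verts) (hzD : z ∈ D.verts)
    (hwC : w ∈ C.verts) (hwD : w ∈ D.verts) : z = w := by
  obtain ⟨K, -⟩ := h.exists_cycleCoords hC hzC
  obtain ⟨L, -⟩ := h.exists_cycleCoords hD hzD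
  rw [← K.vert_gate hzC, ← K.vert_gate hwC, K.gate_eq_of_disjoint L (h.2 hC hD hCD) hzD hwD]

/-- A leafless cactus whose cycles pairwise intersect is a daisy graph. -/
theorem IsCactus.isDaisy [Finite V] (h : G.IsCactus) (hleaf : ∀ v, ¬ ∃! w, G.Adj v w)
    (hnt : G.cycles.Nontrivial)
    (hint : ∀ C ∈ G.cycles, ∀ D ∈ G.cycles, C ≠ D → ¬ Disjoint C.verts D.verts) :
    G.IsDaisy := by
  obtain ⟨C, hC, D, hD, hCD⟩ := hnt
  obtain ⟨x, hxC, hxD⟩ := Set.not_disjoint_iff.1 (hint C hC D hD hCD)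
  obtain ⟨K, -⟩ := h.exists_cycleCoords hC hxC
  have hx : ∀ E ∈ G.cycles, x ∈ E.verts := by
    intro E hE
    by_cases hEC : E = C
    · exact hEC ▸ hxC
    by_cases hED : E = D
    · exact hED ▸ hxD
    obtain ⟨z, hzE, hzC⟩ := Set.not_disjoint_iff.1 (hint E hE C hC hEC)
    obtain ⟨y, hyE, hyD⟩ := Set.not_disjoint_iff.1 (hint E hE D hD hED)
    obtain ⟨L, -⟩ := h.exists_cycleCoords hE hzE
    obtain ⟨M, -⟩ := h.exists_cycleCoords hD hxD
    -- Seen from `C`, all of `E` hangs at `z` and all of `D` at `x`; the common vertex `y` forces `z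
    -- = x`.
    have h1 := K.gate_eq_of_disjoint L (h.2 hC hE (Ne.symm hEC)) hzE hyE
    have h2 := K.gate_eq_of_disjoint M (h.2 hC hD hCD) hyD hxD
    rw [← K.vert_gate hxC, ← h2, ← h1, K.vert_gate hzC]
    exact hzE
  have hedge : ∀ a b, G.Adj a b → ∃ E ∈ G.cycles, E.Adj a b := by
    intro a b hab
    by_contra! hno
    have hbr := not_reachable_of_notMem_cycles hab hno
    -- The cycles on the two sides of a bridge would both contain `x`.
    obtain ⟨E, hE, hEb⟩ := exists_cycle_of_isBridge hleaf hab hbr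
    obtain ⟨F, hF, hFa⟩ := exists_cycle_of_isBridge hleaf hab.symm (b := a)
      (fun hr => hbr (by rw [Sym2.eq_swap]; exact hr.symm))
    have h1 := hEb x (hx E hE)
    have h2 := hFa x (hx F hF)
    rw [Sym2.eq_swap] at h2
    exact hbr (h2.symm.trans h1)
  refine ⟨x, G.cycles, ⟨C, hC, D, hD, hCD⟩, subset_rfl, fun E hE F hF hEF => ?_, ?_⟩
  · ext z
    exact ⟨fun hz => h.eq_of_mem_verts hE hF hEF hz.1 hz.2 (hx E hE) (hx F hF),
      fun hz => hz ▸ ⟨hx E hE, hx F hF⟩⟩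
  · have hadj : ∀ a b, G.Adj a b → (sSup G.cycles : G.Subgraph).Adj a b := fun a b hab =>
      Subgraph.sSup_adj.2 (hedge a b hab)
    have : Nontrivial V := by
      have := K.adj_vert 0 (by have := K.three_le; omega)
      exact ⟨_, _, this.ne⟩
    refine Subgraph.ext ?_ ?_
    · rw [Subgraph.verts_top, Set.eq_univ_iff_forall]
      intro v
      obtain ⟨w, hw⟩ := h.1.preconnected.exists_adj_of_nontrivial v
      exact (sSup G.cycles : G.Subgraph).edge_vert (hadj v w hw)
    · ext a b
      exact ⟨fun hab => Subgraph.top_adj.2 (Subgraph.adj_sub _ hab),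
        fun hab => hadj a b (Subgraph.top_adj.1 hab)⟩

/-! ### Lower bound for daisy graphs -/

/-- Some vertex of an edge metric generator `S` hangs at a vertex of the cycle other than `0`. If
there is only one such vertex in `S`, then some edge of the cycle is as far from every vertex of
`S` as vertex `0`. -/
theorem CycleCoords.exists_edge_of_gate_eq_zero {C : G.Subgraph} (hG : G.Connected)
    (K : CycleCoords G C) {S : Finset V} (hS : G.IsEdgeMetricGenerator S) {t : V}
    (ht : ∀ s ∈ S, K.gate s ≠ 0 → s = t) :
    (∃ s ∈ S, K.gate s ≠ 0) ∧
      ∃ e ∈ C.edgeSet, ∀ s ∈ S, G.edgeDist s e = G.dist s (K.vert 0) := by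
  have h3 := K.three_le
  have h0 : 0 < K.n := by omega
  have hl : K.n - 1 < K.n := by omega
  have he : ∀ i < K.n, s(K.vert i, K.vert (i + 1)) ∈ C.edgeSet := fun i hi =>
    (K.mem_edgeSet _).2 ⟨i, hi, rfl⟩
  have hne : s(K.vert 0, K.vert (0 + 1)) ≠ s(K.vert (K.n - 1), K.vert (K.n - 1 + 1)) := by
    intro heq
    have h1 := K.edgeDist_vert_edge hG (k := 1) (by omega) h0
    rw [heq, K.edgeDist_vert_edge hG (by omega) hl, cycEdgeDist_one h3 h0,
      cycEdgeDist_one h3 hl] at h1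
    omega
  have hEG : ∀ e ∈ C.edgeSet, e ∈ G.edgeSet := fun e he => C.edgeSet_subset he
  have hzero : ∀ s, K.gate s = 0 → ∀ i, i = 0 ∨ i = K.n - 1 →
      G.edgeDist s s(K.vert i, K.vert (i + 1)) = G.dist s (K.vert 0) := by
    intro s hs i hi
    -- Edges `0` and `n - 1` are the two edges at vertex `0`.
    rw [K.edgeDist_edge hG s (by omega), hs, cycEdgeDist_zero h3 (by omega)]
    omega
  obtain ⟨s, hs, hsne⟩ := hS _ (hEG _ (he 0 h0)) _ (hEG _ (he _ hl)) hne
  have hs0 : K.gate s ≠ 0 := fun hs0 =>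
    hsne ((hzero s hs0 0 (Or.inl rfl)).trans (hzero s hs0 _ (Or.inr rfl)).symm)
  refine ⟨⟨s, hs, hs0⟩, ?_⟩
  obtain rfl := ht s hs hs0
  have hlt := K.gate_lt s
  suffices ∃ i, (i = 0 ∨ i = K.n - 1) ∧
      cycEdgeDist K.n (K.gate s) i = cycDist K.n (K.gate s) 0 by
    obtain ⟨i, hi, hd⟩ := this
    refine ⟨_, he i (by omega), fun u hu => ?_⟩
    by_cases hu0 : K.gate u = 0
    · exact hzero u hu0 i hi
    · rw [ht u hu hu0, K.edgeDist_edge hG s (by omega), K.dist_to_vert hG s h0, hd]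
  rw [K.edgeDist_edge hG s h0, K.edgeDist_edge hG s hl] at hsne
  -- The edge wanted is the one leading from vertex `0` away from `s`. An antipodal gate would see
  -- both edges equally far.
  rcases lt_trichotomy (2 * K.gate s) K.n with hk | hk | hk
  · refine ⟨K.n - 1, Or.inr rfl, ?_⟩
    unfold cycEdgeDist cycDist
    rw [if_pos (by omega)]
    omega
  · refine (hsne ?_).elim
    unfold cycEdgeDist cycDist
    rw [if_neg (by omega), if_pos (by omega)]
    omega
  · refine ⟨0, Or.inl rfl, ?_⟩
    unfold cycEdgeDist cycDist
    rw [if_neg (by omega)]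
    omega

theorem IsDaisy.le_card_of_isEdgeMetricGenerator [Finite V] (hd : G.IsDaisy) (h : G.IsCactus)
    {S : Finset V} (hS : G.IsEdgeMetricGenerator S) : 2 * G.cycles.ncard ≤ S.card + 1 := by
  classical
  obtain ⟨x, P, hnt, hP, hint, hsup⟩ := hd
  -- Every cycle shares an edge with some petal, hence is that petal.
  have hPeq : G.cycles = P := by
    refine (hP.antisymm fun C hC => ?_).symm
    obtain ⟨v, hv⟩ : C.verts.Nonempty := by
      obtain ⟨v, p, -, rfl⟩ := hC
      exact ⟨v, by simp⟩
    obtain ⟨K, -⟩ := h.exists_cycleCoords hC hv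
    have h0 : 0 < K.n := by have := K.three_le; omega
    have hadj : (sSup P).Adj (K.vert 0) (K.vert (0 + 1)) := by
      rw [hsup]
      exact K.adj_vert 0 h0
    obtain ⟨D, hD, hDadj⟩ := Subgraph.sSup_adj.1 hadj
    by_contra hCP
    exact Set.disjoint_left.1 (h.2 hC (hP hD) (fun h => hCP (h ▸ hD)))
      ((K.mem_edgeSet _).2 ⟨0, h0, rfl⟩) hDadj
  rw [← hPeq] at hint hsup hnt
  have hx : ∀ C ∈ G.cycles, x ∈ C.verts := by
    intro C hC
    obtain ⟨D, hD, hDC⟩ := hnt.exists_ne C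
    have : x ∈ C.verts ∩ D.verts := by rw [hint hC hD hDC.symm]; rfl
    exact this.1
  have hcov : ∀ z, ∃ D ∈ G.cycles, z ∈ D.verts := by
    intro z
    have : z ∈ (sSup G.cycles : G.Subgraph).verts := by rw [hsup]; trivial
    simpa [Subgraph.verts_sSup] using this
  have : Fintype G.cycles := Fintype.ofFinite _
  choose K hK using fun C : G.cycles => h.exists_cycleCoords C.2 (hx C.1 C.2)
  have hgate : ∀ C z, (K C).gate z ≠ 0 → z ∈ C.1.verts ∧ z ≠ x := by
    intro C z hz
    have hx0 : (K C).gate x = 0 := by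
      rw [← hK C]
      exact (K C).gate_vert 0 (by have := (K C).three_le; omega)
    refine ⟨?_, fun h => hz (h ▸ hx0)⟩
    by_contra hzC
    obtain ⟨D, hD, hzD⟩ := hcov z
    have hCD : C.1 ≠ D := fun h => hzC (h ▸ hzD)
    exact hz (((K C).gate_eq_of_disjoint (K ⟨D, hD⟩) (h.2 C.2 hD hCD) hzD (hx D hD)).trans hx0)
  set A : G.cycles → Finset V := fun C => S.filter fun s => (K C).gate s ≠ 0 with hA
  have hAdisj : ∀ C D, C ≠ D → Disjoint (A C) (A D) := by
    intro C D hCD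
    rw [Finset.disjoint_left]
    intro z hzC hzD
    obtain ⟨h1, h2⟩ := hgate C z (Finset.mem_filter.1 hzC).2
    obtain ⟨h3, -⟩ := hgate D z (Finset.mem_filter.1 hzD).2
    have : z ∈ C.1.verts ∩ D.1.verts := ⟨h1, h3⟩
    rw [hint C.2 D.2 (fun h => hCD (Subtype.ext h))] at this
    exact h2 this
  have hpoor : ∀ C, (A C).card ≤ 1 → (A C).Nonempty ∧
      ∃ e ∈ C.1.edgeSet, ∀ s ∈ S, G.edgeDist s e = G.dist s x := by
    intro C hC
    have : Nonempty V := ⟨x⟩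
    obtain ⟨t, ht⟩ := Finset.card_le_one_iff_subset_singleton.1 hC
    obtain ⟨⟨s, hs, hs0⟩, h2⟩ := (K C).exists_edge_of_gate_eq_zero h.1 hS (t := t) fun s hs hs0 =>
      Finset.mem_singleton.1 (ht (Finset.mem_filter.2 ⟨hs, hs0⟩))
    rw [hK C] at h2
    exact ⟨⟨s, Finset.mem_filter.2 ⟨hs, hs0⟩⟩, h2⟩
  have hone : ∀ C D, (A C).card ≤ 1 → (A D).card ≤ 1 → C = D := by
    intro C D hC hD
    by_contra hCD
    obtain ⟨-, e, he, hes⟩ := hpoor C hC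
    obtain ⟨-, f, hf, hfs⟩ := hpoor D hD
    have hdis := h.2 C.2 D.2 (fun h => hCD (Subtype.ext h))
    obtain ⟨s, hs, hne⟩ := hS e (C.1.edgeSet_subset he) f (D.1.edgeSet_subset hf)
      (fun h => Set.disjoint_left.1 hdis he (h ▸ hf))
    exact hne ((hes s hs).trans (hfs s hs).symm)
  have hsum : ∑ C, (A C).card ≤ S.card := by
    rw [← Finset.card_biUnion fun C _ D _ hCD => hAdisj C D hCD]
    exact Finset.card_le_card (Finset.biUnion_subset.2 fun C _ => Finset.filter_subset _ _)
  have h5 : G.cycles.ncard = Fintype.card G.cycles := by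
    rw [← Nat.card_coe_set_eq, Nat.card_eq_fintype_card]
  have hpos : ∀ C, 1 ≤ (A C).card := fun C => by
    by_contra hC
    exact hC (hpoor C (by omega)).1.card_pos
  -- The indicator makes up for a petal with one generator vertex, and by `hone` it is nonzero at
  -- most once.
  have hlow : ∑ C : G.cycles, 2 ≤ ∑ C, ((A C).card + if (A C).card ≤ 1 then 1 else 0) := by
    refine Finset.sum_le_sum fun C _ => ?_
    have := hpos C
    split_ifs <;> omega
  rw [Finset.sum_add_distrib, Finset.sum_const, Finset.card_univ, ← Finset.card_filter] at hlow
  have hle : (Finset.univ.filter fun C => (A C).card ≤ 1).card ≤ 1 :=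
    Finset.card_le_one.2 fun C hC D hD =>
      hone C D (Finset.mem_filter.1 hC).2 (Finset.mem_filter.1 hD).2
  simp only [smul_eq_mul] at hlow
  omega

end SimpleGraph

/-! ### The main theorem -/

theorem mainTheorem2 {V : Type*} [Fintype V] (G : SimpleGraph V) [DecidableRel G.Adj]
    (hcactus : G.IsCactus) (hleafless : ∀ v : V, G.degree v ≠ 1)
    (c : ℕ) (hc : G.cycles.ncard = c) (hc2 : 2 ≤ c) :
    G.edim ≤ 2 * c - 1 ∧ (G.edim = 2 * c - 1 ↔ G.IsDaisy) := by
  classical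
  have hleaf : ∀ v, ¬ ∃! w, G.Adj v w := fun v hv =>
    hleafless v (SimpleGraph.degree_eq_one_iff_existsUnique_adj.2 hv)
  have hnt : G.cycles.Nontrivial := (Set.one_lt_ncard_iff_nontrivial).1 (by omega)
  have hother : ∀ C : G.cycles, ∃ D : G.cycles, D ≠ C := fun C => by
    obtain ⟨D, hD, hDC⟩ := hnt.exists_ne C.1
    exact ⟨⟨D, hD⟩, fun h => hDC (congrArg Subtype.val h)⟩
  choose π hπ using hother
  obtain ⟨C₀, hC₀⟩ := hnt.nonempty
  obtain ⟨S, hS, hScard⟩ := hcactus.exists_isEdgeMetricGenerator hleaf π hπ {⟨C₀, hC₀⟩}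
    (fun C hC D hD hCD => (hCD ((Finset.mem_singleton.1 hC).trans
      (Finset.mem_singleton.1 hD).symm)).elim)
  rw [Finset.card_singleton] at hScard
  have hle  := SimpleGraph.edim_le_card hS
  refine ⟨by omega, fun heq => ?_, fun hd => ?_⟩
  · refine hcactus.isDaisy hleaf hnt ?_
    by_contra! hcon
    obtain ⟨C, hC, D, hD, hCD, hdisj⟩ := hcon
    have hne : (⟨C, hC⟩ : G.cycles) ≠ ⟨D, hD⟩ := fun h => hCD (congrArg Subtype.val h)
    -- Redirecting `π` so that `C` and `D` face each other allows `W = {C, D}`, which saves a second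
    -- vertex.
    obtain ⟨T, hT, hTcard⟩ := hcactus.exists_isEdgeMetricGenerator hleaf
      (fun E => if E = ⟨C, hC⟩ then ⟨D, hD⟩ else if E = ⟨D, hD⟩ then ⟨C, hC⟩ else π E)
      (fun E => by
        split_ifs with h1 h2
        · exact h1 ▸ hne.symm
        · exact h2 ▸ hne
        · exact hπ E)
      {⟨C, hC⟩, ⟨D, hD⟩} (fun E hE F hF hEF => by
        rcases Finset.mem_insert.1 hE with rfl | hE <;>
          rcases Finset.mem_insert.1 hF with rfl | hF
        · exact (hEF rfl).elim
        · obtain rfl := Finset.mem_singleton.1 hF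
          exact ⟨if_pos rfl, hdisj⟩
        · obtain rfl := Finset.mem_singleton.1 hE
          exact ⟨by rw [if_neg hEF, if_pos rfl], hdisj.symm⟩
        · exact (hEF ((Finset.mem_singleton.1 hE).trans (Finset.mem_singleton.1 hF).symm)).elim)
    rw [Finset.card_pair hne] at hTcard
    have  := SimpleGraph.edim_le_card hT
    omega
  · obtain ⟨T, hT, hTcard⟩ : ∃ T : Finset V, G.IsEdgeMetricGenerator T ∧ T.card = G.edim :=
      Nat.sInf_mem (s := {n | ∃ T : Finset V, G.IsEdgeMetricGenerator T ∧ T.card = n})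
        ⟨_, S, hS, rfl⟩
    have := hd.le_card_of_isEdgeMetricGenerator hcactus hT
    omega
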